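/- Let $k\ge 2$ be an integer and let $G$ be a finite simple graph of order $n$ with minimum degree $\delta\ge 1$. Suppose that every independent set $\{x_1,\dots,x_m\}$ of $m=\lfloor (k+\tfrac12)\delta\rfloor+1$ distinct vertices of $G$ satisfies $$\max\{d_G(x_1),\dots,d_G(x_m)\}\ \ge\ \frac{2n}{2k+3}.$$ Then $G$ has a $\{K_{1,1},K_{1,2},\dots,K_{1,k},\mathcal T(2k+1)\}$-factor, that is, a spanning subgraph each of whose connected components is isomorphic to one of the stars $K_{1,1},\dots,K_{1,k}$ or to a tree in $\mathcal T(2k+1)$. Here the family $\mathcal T(2k+1)$ is defined as follows. For a finite tree $R$ let $\mathrm{Leaf}(R)$ be the set of its vertices of degree $1$ and let $R-\mathrm{Leaf}(R)$ be the graph obtained by deleting them. Consider all finite trees $R$ such that every vertex $x\in V(R)\setminus \mathrm{Leaf}(R)$ satisfies (a) $d_{R-\mathrm{Leaf}(R)}(x)\in\{1,3,\dots,2k+1\}$, and (b) $2\,\ell_R(x)+d_{R-\mathrm{Leaf}(R)}(x)\le 2k+1$, where $\ell_R(x)$ is the number of leaves of $R$ adjacent to $x$. From such an $R$ form a tree $T_R$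 by inserting a new vertex of degree $2$ into each edge of $R-\mathrm{Leaf}(R)$ and, for every vertex $x$ of $R-\mathrm{Leaf}(R)$ with $d_{R-\mathrm{Leaf}(R)}(x)=2r+1<2k+1$, adding $k-r-\ell_R(x)$ new pendant edges at $x$. Then $\mathcal T(2k+1)$ is the set of all trees $T_R$ obtained in this way. -/

import Mathlib

namespace ComponentFactor

/-- The leaves of a graph: the vertices with exactly one neighbour. -/
def leaves {W : Type*} (R : SimpleGraph W) : Set W :=
  {v | (R.neighborSet v).ncard = 1}

/-- The graph obtained from `R` by deleting all its leaves. -/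
abbrev core {W : Type*} (R : SimpleGraph W) : SimpleGraph ↥(leaves R)ᶜ :=
  R.induce (leaves R)ᶜ

/-- The degree of a non-leaf vertex in the graph with the leaves deleted. -/
noncomputable def coreDegree {W : Type*} (R : SimpleGraph W) (x : ↥(leaves R)ᶜ) : ℕ :=
  ((core R).neighborSet x).ncard

/-- The number of leaves of `R` adjacent to a non-leaf vertex `x`. -/
noncomputable def leafCount {W : Type*} (R : SimpleGraph W) (x : ↥(leaves R)ᶜ) : ℕ :=
  (R.neighborSet x ∩ leaves R).ncard

/-- A base tree: a tree `R` such that every non-leaf `x` has degree `2 * r + 1` with `r ≤ k` in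
`R` minus its leaves, and twice the number of leaves adjacent to `x` plus that degree is at most
`2 * k + 1`. -/
structure IsBaseTree {W : Type*} (k : ℕ) (R : SimpleGraph W) : Prop where
  isTree : R.IsTree
  coreDegree_mem : ∀ x, ∃ r ≤ k, coreDegree R x = 2 * r + 1
  two_mul_leafCount_add_le : ∀ x, 2 * leafCount R x + coreDegree R x ≤ 2 * k + 1

/-- The number of pendant edges to be added at a non-leaf `x` with `coreDegree R x = 2 * r + 1`,
namely `k - r - leafCount R x`. For a base tree the subtractions are never truncated, and the
value is `0` when `coreDegree R x = 2 * k + 1`. -/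
noncomputable def pendantCount {W : Type*} (k : ℕ) (R : SimpleGraph W) (x : ↥(leaves R)ᶜ) : ℕ :=
  k - (coreDegree R x - 1) / 2 - leafCount R x

/-- The vertices of the tree derived from `R`: those of `R`, one new vertex for each edge of `R`
minus its leaves, and the ends of the new pendant edges. -/
abbrev DerivedVertex {W : Type*} (k : ℕ) (R : SimpleGraph W) : Type _ :=
  W ⊕ ↥(core R).edgeSet ⊕ (Σ x : ↥(leaves R)ᶜ, Fin (pendantCount k R x))

/-- The tree derived from `R`: every edge of `R` minus its leaves is subdivided once (the other
edges of `R` are kept), and `pendantCount k R x` pendant edges are added at each non-leaf `x`.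
(`SimpleGraph.fromRel` takes the symmetric closure of the relation.) -/
def derivedTree {W : Type*} (k : ℕ) (R : SimpleGraph W) : SimpleGraph (DerivedVertex k R) :=
  SimpleGraph.fromRel fun a b =>
    match a, b with
    | Sum.inl v, Sum.inl w => R.Adj v w ∧ (v ∈ leaves R ∨ w ∈ leaves R)
    | Sum.inl v, Sum.inr (Sum.inl e) => ∃ x ∈ e.1, x.1 = v
    | Sum.inl v, Sum.inr (Sum.inr p) => p.1.1 = v
    | _, _ => False

/-- `T` is isomorphic to a member of the family `𝒯(2k+1)`, that is, to the tree derived from some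
(finite) base tree. -/
def IsSpecialTree {U : Type*} (k : ℕ) (T : SimpleGraph U) : Prop :=
  ∃ (m : ℕ) (R : SimpleGraph (Fin m)), IsBaseTree k R ∧ Nonempty (T ≃g derivedTree k R)

/-- `T` is isomorphic to one of the stars `K_{1,1}, …, K_{1,k}`. -/
def IsSmallStar {U : Type*} (k : ℕ) (T : SimpleGraph U) : Prop :=
  ∃ j, 1 ≤ j ∧ j ≤ k ∧ Nonempty (T ≃g completeBipartiteGraph (Fin 1) (Fin j))

/-- `G` has a `{K_{1,1}, …, K_{1,k}, 𝒯(2k+1)}`-factor: a spanning subgraph `H`, each of whose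
connected components is isomorphic to one of `K_{1,1}, …, K_{1,k}` or to a member of
`𝒯(2k+1)`. -/
def HasStarTreeFactor {V : Type*} (k : ℕ) (G : SimpleGraph V) : Prop :=
  ∃ H : SimpleGraph V, H ≤ G ∧
    ∀ c : H.ConnectedComponent, IsSmallStar k c.toSimpleGraph ∨ IsSpecialTree k c.toSimpleGraph

end ComponentFactor

/-! Call a vertex isolated by `T` if it lies outside `T` and has all its neighbours in `T`. The
degree condition enters only through a count: the isolated vertices form an independent set, and
each has degree at most `#T`. If there were more than `(k + 1/2) * #T` of them, then `m` of them
could be chosen, the hypothesis would give `#T ≥ 2n / (2k + 3)`, and yet `n ≥ #T + #I > (k + 3/2) *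
#T`. So every `T` satisfies `2 * #I ≤ (2k + 1) * #T`, and this suffices for a factor
(`hasStarTreeFactor_of_isolated`).

For the sufficiency, take `S` maximising the number of isolated vertices minus `#S`, let `I` be the
set isolated by `S`, and let `U` be the remaining vertices. By maximality Hall's condition holds
inside `U`, so `U` has an injection into itself along edges and is covered by stars with one or two
edges (`exists_star_cover`).

Between `I` and `S`, each vertex of `I` distributes two units among its neighbours so that each
vertex of `S` receives between `1` and `2k + 1` (`exists_isAssignment`). Choose such a distribution
with the fewest positive amounts. Its support is a forest (`IsMinAssignment.isAcyclic`), and if a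
vertex splits its units between `s` and `t`, then both loads are `1` or both are `2k + 1`
(`load_of_ne`). A component without a split is a star with at most `k` edges; a split with loads `1`
is a `K_{1,2}`; otherwise all loads in the component are `2k + 1`. In that last case split vertices
subdivide edges and unsplit ones are leaves, so at each `s` twice the leaves plus the core degree is
exactly `2k + 1`: the component is the tree derived from its contraction, with no pendant edges to
add (`SpecialShape`). -/

namespace ComponentFactor
open Finset

/-! ### Distributing units by Hall's theorem -/

/-- An assignment of two units from each vertex of `I` to its neighbours in `S`, each vertex of `S`
receiving between `1` and `N` units. -/
structure IsAssignment {V : Type*} [Fintype V] (r : V → V → Prop) (I S : Finset V) (N : ℕ)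
    (x : V → V → ℕ) : Prop where
  supp : ∀ v s, x v s ≠ 0 → v ∈ I ∧ s ∈ S ∧ r v s
  row : ∀ v ∈ I, ∑ s, x v s = 2
  load_pos : ∀ s ∈ S, 1 ≤ ∑ v, x v s
  load_le : ∀ s ∈ S, ∑ v, x v s ≤ N

-- Give each `s` in `S` a row of `N` slots, and match to the slots the `2 * #I` units together with
-- enough dummies to make the numbers equal. Dummies are barred from slot `z`, so in the resulting
-- perfect matching every `s` gets a genuine unit in that slot.
open Classical in
theorem exists_isAssignment {V : Type*} [Fintype V] (r : V → V → Prop)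
    (I S : Finset V) (N : ℕ) (hN : 1 ≤ N)
    (h1 : ∀ X ⊆ I, 2 * #X ≤ N * #{s ∈ S | ∃ v ∈ X, r v s})
    (h2 : ∀ T ⊆ S, #T ≤ #{v ∈ I | ∃ s ∈ T, r v s}) :
    ∃ x, IsAssignment r I S N x := by
  let z : Fin N := ⟨0, hN⟩
  have hIS : 2 * #I ≤ N * #S :=
    (h1 I subset_rfl).trans (Nat.mul_le_mul_left _ (card_le_card (filter_subset _ _)))
  let t : (I × Fin 2) ⊕ Fin (N * #S - 2 * #I) → Finset (V × Fin N) :=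
    Sum.elim (fun p => {s ∈ S | r p.1 s} ×ˢ univ) (fun _ => S ×ˢ univ.erase z)
  have hall : ∀ Y, #Y ≤ #(Y.biUnion t) := by
    intro Y
    let X : Finset V := {v ∈ I | ∃ p : I × Fin 2, p.1.1 = v ∧ Sum.inl p ∈ Y}
    let Γ : Finset V := {s ∈ S | ∃ v ∈ X, r v s}
    have hXI : X ⊆ I := filter_subset _ _
    have hΓS : Γ ⊆ S := filter_subset _ _
    have hY := card_toLeft_add_card_toRight (u := Y)
    have hL : #Y.toLeft ≤ 2 * #X := by
      have : #Y.toLeft ≤ #(X ×ˢ (univ : Finset (Fin 2))) := by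
        refine card_le_card_of_injOn (fun p => (p.1.1, p.2)) ?_ ?_
        · intro p hp
          have hp' : Sum.inl p ∈ Y := by simpa using hp
          simp only [coe_product, coe_univ, Set.mem_prod, Set.mem_univ, and_true, mem_coe, X,
            mem_filter]
          exact ⟨p.1.2, p, rfl, hp'⟩
        · rintro ⟨⟨a, ha⟩, i⟩ - ⟨⟨b, hb⟩, j⟩ - h
          simpa using h
      rw [card_product, card_univ, Fintype.card_fin] at this
      omega
    have hΓ : Γ ×ˢ univ ⊆ Y.biUnion t := by
      rintro ⟨s, i⟩ hs
      simp only [mem_product, mem_univ, and_true, Γ, X, mem_filter] at hs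
      obtain ⟨hsS, v, ⟨hv, p, rfl, hp⟩, hr⟩ := hs
      rw [mem_biUnion]
      exact ⟨_, hp, by simp [t, hsS, hr]⟩
    -- Without dummies, Hall's condition is `h1`. A single dummy already reaches every slot other
    -- than `z`, and what is left is `#(S \ Γ) ≤ 2 * #(I \ X)`, which follows from `h2` because no
    -- vertex of `X` has a neighbour in `S \ Γ`.
    rcases Y.toRight.eq_empty_or_nonempty with h | ⟨d, hd⟩
    · have h3 := card_le_card hΓ
      rw [card_product, card_univ, Fintype.card_fin] at h3
      have h4 := h1 X hXI
      rw [h, card_empty] at hY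
      change _ ≤ N * #Γ at h4
      nlinarith
    · have hd' : Sum.inr d ∈ Y := by simpa using hd
      have h3 : #((Γ ×ˢ {z}) ∪ (S ×ˢ univ.erase z)) ≤ #(Y.biUnion t) := by
        refine card_le_card (union_subset ?_ ?_)
        · exact (product_subset_product_right (subset_univ _)).trans hΓ
        · exact fun q hq => mem_biUnion.2 ⟨_, hd', hq⟩
      rw [card_union_of_disjoint, card_product, card_product, card_singleton,
        card_erase_of_mem (mem_univ _), card_univ, Fintype.card_fin] at h3
      · have hR : #Y.toRight ≤ N * #S - 2 * #I := by
          simpa using card_le_univ Y.toRight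
        have h4 := h2 (S \ Γ) sdiff_subset
        have h5 : #{v ∈ I | ∃ s ∈ S \ Γ, r v s} ≤ #(I \ X) := by
          refine card_le_card fun v hv => ?_
          simp only [mem_filter, mem_sdiff] at hv ⊢
          obtain ⟨hv, s, ⟨hs, hn⟩, hr⟩ := hv
          exact ⟨hv, fun hX => hn (mem_filter.2 ⟨hs, v, hX, hr⟩)⟩
        rw [card_sdiff_of_subset hΓS] at h4
        rw [card_sdiff_of_subset hXI] at h5
        have h6 := card_le_card hXI
        have h7 := card_le_card hΓS
        have h8 : #S * (N - 1) + #S = N * #S := by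
          obtain ⟨M, rfl⟩ : ∃ M, N = M + 1 := ⟨N - 1, by omega⟩
          simp only [Nat.add_sub_cancel]; ring
        omega
      · rw [disjoint_left]
        rintro ⟨a, i⟩ h h'
        simp_all
  obtain ⟨F, hF, hFt⟩ := (all_card_le_biUnion_card_iff_exists_injective t).1 hall
  have hFS : ∀ y, (F y).1 ∈ S := by
    intro y
    have := hFt y
    rcases y with p | d <;> simp [t] at this <;> tauto
  -- Both sides of the matching have `N * #S` elements, so the injection is onto and every slot is
  -- filled.
  have himg : univ.image F = S ×ˢ (univ : Finset (Fin N)) := by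
    refine eq_of_subset_of_card_le ?_ ?_
    · intro q hq
      obtain ⟨y, -, rfl⟩ := mem_image.1 hq
      simp [hFS]
    · rw [card_image_of_injective _ hF]
      simp only [card_product, card_univ, Fintype.card_sum, Fintype.card_prod, Fintype.card_coe,
        Fintype.card_fin]
      have := Nat.mul_comm (#S) N
      omega
  let x : V → V → ℕ := fun v s => #{p : I × Fin 2 | p.1.1 = v ∧ (F (Sum.inl p)).1 = s}
  have hload : ∀ s, ∑ v, x v s = #{p : I × Fin 2 | (F (Sum.inl p)).1 = s} := by
    intro s
    rw [card_eq_sum_card_fiberwise (f := fun p : I × Fin 2 => p.1.1) (t := univ) (by simp)]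
    refine sum_congr rfl fun v _ => ?_
    simp only [x, filter_filter, and_comm]
  refine ⟨x, ⟨fun v s h => ?_, fun v hv => ?_, fun s hs => ?_, fun s hs => ?_⟩⟩
  · obtain ⟨p, hp⟩ := card_ne_zero.1 h
    obtain ⟨-, rfl, rfl⟩ := mem_filter.1 hp
    have := hFt (Sum.inl p)
    simp only [t, Sum.elim_inl, mem_product, mem_filter] at this
    exact ⟨p.1.2, this.1⟩
  · have : ∑ s, x v s = #{p : I × Fin 2 | p.1.1 = v} := by
      rw [card_eq_sum_card_fiberwise (f := fun p : I × Fin 2 => (F (Sum.inl p)).1) (t := univ)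
        (by simp)]
      simp only [x, filter_filter]
    rw [this]
    have : ({p : I × Fin 2 | p.1.1 = v} : Finset _) = {(⟨v, hv⟩ : I)} ×ˢ univ := by
      ext ⟨⟨a, ha⟩, i⟩
      simp [eq_comm]
    rw [this, card_product, card_singleton, card_univ, Fintype.card_fin]
  · rw [hload, Nat.one_le_iff_ne_zero, card_ne_zero]
    have : (s, z) ∈ univ.image F := by rw [himg]; simp [hs]
    obtain ⟨y, -, hy⟩ := mem_image.1 this
    rcases y with p | d
    · exact ⟨p, by simp [hy]⟩
    · have := hFt (Sum.inr d)
      simp [hy, t] at this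
  · rw [hload]
    calc _ ≤ #(univ : Finset (Fin N)) := by
          refine card_le_card_of_injOn (fun p => (F (Sum.inl p)).2) (by simp) ?_
          intro p hp q hq h
          simp only [coe_filter, mem_univ, true_and, Set.mem_ofPred_eq] at hp hq
          exact Sum.inl_injective (hF (Prod.ext (hp.trans hq.symm) h))
      _ = N := by simp

/-! ### Signed flow along a walk -/

section Flow

variable {V : Type*} {H : SimpleGraph V}

open Classical in
/-- The net number of times that a walk uses the dart `(a, b)`. -/
noncomputable def flow : ∀ {u w : V}, H.Walk u w → V → V → ℤ
  | _, _, .nil, _, _ => 0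
  | u, _, .cons (v := v) _ p, a, b =>
    flow p a b + (if a = u ∧ b = v then 1 else 0) - (if a = v ∧ b = u then 1 else 0)

theorem flow_swap {u w : V} (p : H.Walk u w) (a b : V) : flow p a b = - flow p b a := by
  induction p with
  | nil => simp [flow]
  | @cons u v w h p ih =>
    simp only [flow, ih]
    split_ifs <;> first | (exfalso; tauto) | ring

-- Kirchhoff's law: for a closed walk the net flow vanishes at every vertex.
open Classical in
theorem sum_flow [Fintype V] {u w : V} (p : H.Walk u w) (a : V) :
    ∑ b, flow p a b = (if a = u then 1 else 0) - (if a = w then 1 else 0) := by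
  induction p with
  | nil => simp [flow]
  | cons h p ih =>
    simp only [flow, sum_sub_distrib, sum_add_distrib, ih, ite_and]
    simp
    ring

open Classical in
theorem abs_flow_le {u w : V} (p : H.Walk u w) (a b : V) :
    |flow p a b| ≤ p.edges.count s(a, b) := by
  induction p with
  | nil => simp [flow]
  | @cons u v w h p ih =>
    have hne := h.ne
    simp only [flow, SimpleGraph.Walk.edges_cons, List.count_cons]
    rw [abs_le] at ih ⊢
    by_cases h1 : a = u ∧ b = v
    · obtain ⟨rfl, rfl⟩ := h1
      simp [hne]; omega
    · by_cases h2 : a = v ∧ b = u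
      · obtain ⟨rfl, rfl⟩ := h2
        have : (s(b, a) == s(a, b)) = true := by simp [Sym2.eq_swap]
        simp [hne.symm, this]; omega
      · simp only [h1, h2, if_false]
        push_cast
        split_ifs <;> simp <;> omega

-- With the bound `abs_flow_le`, this parity forces the values `1` or `-1` on the edges of a trail.
open Classical in
theorem flow_emod_two {u w : V} (p : H.Walk u w) (a b : V) :
    (flow p a b - p.edges.count s(a, b)) % 2 = 0 := by
  induction p with
  | nil => simp [flow]
  | @cons u v w h p ih =>
    have hne := h.ne
    simp only [flow, SimpleGraph.Walk.edges_cons, List.count_cons]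
    by_cases h1 : a = u ∧ b = v
    · obtain ⟨rfl, rfl⟩ := h1
      simp [hne]; omega
    · by_cases h2 : a = v ∧ b = u
      · obtain ⟨rfl, rfl⟩ := h2
        have : (s(b, a) == s(a, b)) = true := by simp [Sym2.eq_swap]
        simp [hne.symm, this]; omega
      · have : ¬ (s(u, v) == s(a, b)) = true := by
          simp only [beq_iff_eq, Sym2.eq_iff]; tauto
        simp only [h1, h2, this, if_false]
        push_cast
        omega

theorem flow_eq_zero {u w : V} (p : H.Walk u w) {a b : V} (h : s(a, b) ∉ p.edges) :
    flow p a b = 0 := by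
  classical
  have := abs_flow_le p a b
  rw [List.count_eq_zero_of_not_mem h] at this
  simpa using this

theorem flow_eq_one_or {u w : V} {p : H.Walk u w} (hp : p.IsTrail) {a b : V}
    (h : s(a, b) ∈ p.edges) : flow p a b = 1 ∨ flow p a b = -1 := by
  classical
  have h1 := abs_flow_le p a b
  have h2 := flow_emod_two p a b
  rw [List.count_eq_one_of_mem hp.edges_nodup h] at h1 h2
  rw [abs_le] at h1
  omega

end Flow

/-! ### Assignments of minimal support -/

section Minimal

variable {V : Type*} [Fintype V] {r : V → V → Prop} {I S : Finset V} {N : ℕ} {x : V → V → ℕ}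

/-- The graph joining each vertex to those to which it assigns a positive amount. -/
def supportGraph (x : V → V → ℕ) : SimpleGraph V :=
  SimpleGraph.fromRel fun v s => x v s ≠ 0

/-- The number of pairs with a positive amount. -/
noncomputable def supportCard (x : V → V → ℕ) : ℕ :=
  #{p : V × V | x p.1 p.2 ≠ 0}

/-- An assignment with the least possible number of positive amounts. -/
structure IsMinAssignment (r : V → V → Prop) (I S : Finset V) (N : ℕ) (x : V → V → ℕ) : Prop
    extends IsAssignment r I S N x where
  disj : Disjoint I S
  minimal : ∀ y, IsAssignment r I S N y → supportCard x ≤ supportCard y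

theorem exists_isMinAssignment (hd : Disjoint I S) (h : ∃ x, IsAssignment r I S N x) :
    ∃ x, IsMinAssignment r I S N x := by
  obtain ⟨x, hx, hmin⟩ := WellFounded.has_min (measure (supportCard (V := V))).wf
    {x | IsAssignment r I S N x} h
  exact ⟨x, hx, hd, fun y hy => not_lt.1 (hmin y hy)⟩

theorem supportCard_lt {x y : V → V → ℕ} (hsub : ∀ a b, x a b ≠ 0 → y a b ≠ 0) {a b : V}
    (hx : x a b = 0) (hy : y a b ≠ 0) : supportCard x < supportCard y := by
  refine card_lt_card ⟨fun p hp => ?_, fun h => ?_⟩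
  · simp only [mem_filter, mem_univ, true_and] at hp ⊢
    exact hsub _ _ hp
  · have := @h (a, b) (by simpa using hy)
    simp [hx] at this

namespace IsMinAssignment

theorem adj_left (h : IsMinAssignment r I S N x) {v w : V} (hv : v ∈ I) :
    (supportGraph x).Adj v w ↔ x v w ≠ 0 := by
  have hd := disjoint_left.1 h.disj
  simp only [supportGraph, SimpleGraph.fromRel_adj]
  constructor
  · rintro ⟨-, h1 | h1⟩
    · exact h1
    · exact absurd (h.supp _ _ h1).2.1 (hd hv)
  · intro h1
    refine ⟨?_, Or.inl h1⟩
    rintro rfl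
    exact hd hv (h.supp _ _ h1).2.1

theorem adj_right (h : IsMinAssignment r I S N x) {v w : V} (hw : w ∈ S) :
    (supportGraph x).Adj v w ↔ x v w ≠ 0 := by
  have hd := disjoint_left.1 h.disj
  constructor
  · intro ha
    rcases ha with ⟨-, h1 | h1⟩
    · exact h1
    · exact absurd hw (hd (h.supp _ _ h1).1)
  · intro h1
    exact (h.adj_left (h.supp _ _ h1).1).2 h1

theorem mem_of_adj (h : IsMinAssignment r I S N x) {v w : V} (ha : (supportGraph x).Adj v w) :
    (v ∈ I ∧ w ∈ S ∧ x v w ≠ 0) ∨ (v ∈ S ∧ w ∈ I ∧ x w v ≠ 0) := by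
  rcases ha with ⟨-, h1 | h1⟩
  · exact Or.inl ⟨(h.supp _ _ h1).1, (h.supp _ _ h1).2.1, h1⟩
  · exact Or.inr ⟨(h.supp _ _ h1).2.1, (h.supp _ _ h1).1, h1⟩

theorem le_two (h : IsMinAssignment r I S N x) {v : V} (hv : v ∈ I) (s : V) : x v s ≤ 2 :=
  (single_le_sum (f := x v) (by simp) (mem_univ s)).trans_eq (h.row v hv)

theorem add_eq_two (h : IsMinAssignment r I S N x) {v s t : V} (hst : s ≠ t)
    (hs : x v s ≠ 0) (ht : x v t ≠ 0) :
    x v s = 1 ∧ x v t = 1 ∧ ∀ w, w ≠ s → w ≠ t → x v w = 0 := by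
  classical
  have hv := (h.supp _ _ hs).1
  have hrow := h.row v hv
  rw [← add_sum_erase _ _ (mem_univ s), ← add_sum_erase _ _ (mem_erase.2 ⟨hst.symm, mem_univ t⟩)]
    at hrow
  refine ⟨by omega, by omega, fun w hw hw' => ?_⟩
  have hz : ∑ a ∈ (univ.erase s).erase t, x v a = 0 := by omega
  exact (sum_eq_zero_iff.1 hz) w (by simp [hw, hw'])

theorem eq_two (h : IsMinAssignment r I S N x) {v s : V} (hv : v ∈ I)
    (hs : ∀ w, x v w ≠ 0 → w = s) : x v s = 2 := by
  rw [← h.row v hv]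
  exact (sum_eq_single s (fun w _ hw => by_contra fun h' => hw (hs w h')) (by simp)).symm

theorem eq_of_eq_two (h : IsMinAssignment r I S N x) {v s w : V} (hs : x v s = 2)
    (hw : x v w ≠ 0) : w = s := by
  by_contra hne
  have := (h.add_eq_two hne hw (by omega)).2.1
  omega

theorem exists_other (h : IsMinAssignment r I S N x) {v s : V} (hs : x v s = 1) :
    ∃ t, t ≠ s ∧ x v t = 1 := by
  by_contra! hcon
  have hv := (h.supp v s (by omega)).1
  have := h.eq_two (s := s) hv fun w hw => by
    by_contra hne
    exact hcon w hne (h.add_eq_two hne hw (by omega)).1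
  omega

/-- Moving a unit from `s` to `t` violates one of the bounds on the loads. -/
theorem load_of_ne_aux (h : IsMinAssignment r I S N x) {v s t : V} (hst : s ≠ t)
    (hs : x v s ≠ 0) (ht : x v t ≠ 0) :
    ∑ u, x u s ≤ 1 ∨ N ≤ ∑ u, x u t := by
  classical
  by_contra! hcon
  obtain ⟨h1, h2, h3⟩ := h.add_eq_two hst hs ht
  let y : V → V → ℕ := fun a b =>
    if a = v then (if b = s then 0 else if b = t then 2 else 0) else x a b
  have hyv : ∀ b, y v b = if b = s then 0 else if b = t then 2 else 0 := fun b => if_pos rfl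
  have hyn : ∀ a b, a ≠ v → y a b = x a b := fun a b ha => if_neg ha
  have hsum : ∀ b, ∑ a, y a b + x v b = ∑ a, x a b + y v b := by
    intro b
    rw [← add_sum_erase _ _ (mem_univ v), ← add_sum_erase _ (fun a => x a b) (mem_univ v),
      sum_congr rfl fun a ha => hyn a b (ne_of_mem_erase ha)]
    ring
  have hsub : ∀ a b, y a b ≠ 0 → x a b ≠ 0 := by
    intro a b hab
    by_cases ha : a = v
    · subst ha
      rw [hyv] at hab
      split_ifs at hab with hb hb' <;> simp_all
    · rwa [hyn a b ha] at hab
  have hy : IsAssignment r I S N y := by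
    refine ⟨fun a b hab => h.supp a b (hsub a b hab), fun a ha => ?_, fun b hb => ?_,
      fun b hb => ?_⟩
    · by_cases hav : a = v
      · subst hav
        simp only [hyv]
        rw [sum_eq_single t] <;> simp +contextual [hst.symm]
      · simp only [hyn a _ hav, h.row a ha]
    all_goals
      have hb1 := hsum b
      rw [hyv] at hb1
      have hb2 := h.load_pos b hb
      have hb3 := h.load_le b hb
      split_ifs at hb1 with e1 e2
      · subst e1; omega
      · subst e2; omega
      · have := h3 b e1 e2; omega
  have := supportCard_lt hsub (a := v) (b := s) (by rw [hyv]; simp) hs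
  exact absurd (h.minimal y hy) (by omega)

/-- A unit can be shifted neither from `s` to `t` nor from `t` to `s`. Since `1` and `N` differ, the
two obstructions are compatible only when both loads sit at the same bound. -/
theorem load_of_ne (h : IsMinAssignment r I S N x) (hN : 2 ≤ N) {v s t : V} (hst : s ≠ t)
    (hs : x v s ≠ 0) (ht : x v t ≠ 0) :
    (∑ u, x u s = 1 ∧ ∑ u, x u t = 1) ∨ (∑ u, x u s = N ∧ ∑ u, x u t = N) := by
  have h1 := h.load_of_ne_aux hst hs ht
  have h2 := h.load_of_ne_aux hst.symm ht hs
  have hs' := (h.supp _ _ hs).2.1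
  have ht' := (h.supp _ _ ht).2.1
  have := h.load_pos s hs'
  have := h.load_pos t ht'
  have := h.load_le s hs'
  have := h.load_le t ht'
  omega

/-- On a cycle each vertex of `I` splits its units, one to each of its cycle edges. Adding the flow
of the cycle keeps all row sums and loads but turns these ones alternately into `2` and `0`, which
shrinks the support. -/
theorem isAcyclic (h : IsMinAssignment r I S N x) : (supportGraph x).IsAcyclic := by
  classical
  intro u c hc
  have hd := disjoint_left.1 h.disj
  -- amounts on the edges of the cycle are equal to one
  obtain ⟨v, hvI, hvc⟩ : ∃ v ∈ I, v ∈ c.support := by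
    have hadj := c.adj_snd hc.not_nil
    rcases h.mem_of_adj hadj with h1 | h1
    · exact ⟨_, h1.1, c.start_mem_support⟩
    · exact ⟨_, h1.2.1, c.getVert_mem_support 1⟩
  have hone : ∀ a ∈ I, ∀ b, s(a, b) ∈ c.edges →
      x a b = 1 ∧ ∃ b', b' ≠ b ∧ s(a, b') ∈ c.edges := by
    intro a ha b hab
    have h2 := hc.ncard_neighborSet_toSubgraph_eq_two
      (c.mem_support_of_mem_edges hab (Sym2.mem_mk_left a b))
    obtain ⟨b', hb', hne⟩ := Set.exists_ne_of_one_lt_ncard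
      (s := c.toSubgraph.neighborSet a) (by omega) b
    have hab' : s(a, b') ∈ c.edges := by
      exact c.adj_toSubgraph_iff_mem_edges.1 hb'
    have e1 := (h.adj_left ha).1 (c.adj_of_mem_edges hab)
    have e2 := (h.adj_left ha).1 (c.adj_of_mem_edges hab')
    exact ⟨(h.add_eq_two hne.symm e1 e2).1, b', hne, hab'⟩
  -- `toNat` never truncates here: a flow of `-1` occurs only where the amount is `1`.
  let y : V → V → ℕ := fun a b => if a ∈ I then (x a b + flow c a b).toNat else 0
  have hycast : ∀ a ∈ I, ∀ b, (y a b : ℤ) = x a b + flow c a b := by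
    intro a ha b
    simp only [y, if_pos ha]
    by_cases hab : s(a, b) ∈ c.edges
    · have := (hone a ha b hab).1
      rcases flow_eq_one_or hc.isTrail hab with h' | h' <;> simp [this, h']
    · simp [flow_eq_zero c hab]
  have hsub : ∀ a b, y a b ≠ 0 → x a b ≠ 0 := by
    intro a b hab hx
    by_cases ha : a ∈ I
    · by_cases he : s(a, b) ∈ c.edges
      · exact (h.adj_left ha).1 (c.adj_of_mem_edges he) hx
      · have := hycast a ha b
        rw [flow_eq_zero c he, hx] at this
        simp at this
        exact hab this
    · exact hab (if_neg ha)
  have hload : ∀ s ∈ S, ∑ a, y a s = ∑ a, x a s := by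
    intro s hs
    have h1 : ∀ a, (y a s : ℤ) = x a s + flow c a s := by
      intro a
      by_cases ha : a ∈ I
      · exact hycast a ha s
      · have hx : x a s = 0 := by
          by_contra hx
          exact ha (h.supp _ _ hx).1
        have hf : flow c a s = 0 := by
          refine flow_eq_zero c fun he => ?_
          exact (h.adj_right hs).1 (c.adj_of_mem_edges he) hx
        simp [y, ha, hx, hf]
    have h2 : ∑ a, flow c a s = 0 := by
      rw [sum_congr rfl fun a _ => flow_swap c a s, sum_neg_distrib, sum_flow]; simp
    have : (∑ a, y a s : ℤ) = ∑ a, (x a s : ℤ) := by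
      rw [sum_congr rfl fun a _ => h1 a, sum_add_distrib, h2, add_zero]
    exact_mod_cast this
  have hy : IsAssignment r I S N y := by
    refine ⟨fun a b hab => h.supp a b (hsub a b hab), fun a ha => ?_, fun b hb => ?_,
      fun b hb => ?_⟩
    · have : (∑ b, y a b : ℤ) = 2 := by
        rw [sum_congr rfl fun b _ => hycast a ha b, sum_add_distrib, sum_flow, sub_self, add_zero]
        exact_mod_cast h.row a ha
      exact_mod_cast this
    · rw [hload b hb]; exact h.load_pos b hb
    · rw [hload b hb]; exact h.load_le b hb
  obtain ⟨w, hw⟩ : ∃ w, s(v, w) ∈ c.edges := by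
    have h2 := hc.ncard_neighborSet_toSubgraph_eq_two hvc
    obtain ⟨w, hw⟩ := Set.nonempty_of_ncard_ne_zero (s := c.toSubgraph.neighborSet v) (by omega)
    exact ⟨w, c.adj_toSubgraph_iff_mem_edges.1 hw⟩
  -- The flow out of `v` sums to zero and is not identically zero, so some cycle edge at `v` carries
  -- `-1`.
  obtain ⟨s, hse, hs⟩ : ∃ s, s(v, s) ∈ c.edges ∧ flow c v s = -1 := by
    by_contra! hcon
    have hnn : ∀ s ∈ univ, 0 ≤ flow c v s := by
      intro s _
      by_cases he : s(v, s) ∈ c.edges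
      · rcases flow_eq_one_or hc.isTrail he with h' | h'
        · omega
        · exact absurd h' (hcon s he)
      · exact (flow_eq_zero c he).ge
    have h0 : ∑ s, flow c v s = 0 := by rw [sum_flow, sub_self]
    have := (sum_eq_zero_iff_of_nonneg hnn).1 h0 w (mem_univ w)
    rcases flow_eq_one_or hc.isTrail hw with h' | h' <;> omega
  have hx1 := (hone v hvI s hse).1
  have hlt := supportCard_lt hsub (a := v) (b := s)
    (by have := hycast v hvI s; rw [hx1, hs] at this; simpa using this) (by omega)
  exact absurd (h.minimal y hy) (by omega)

end IsMinAssignment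

end Minimal

/-! ### Recognising small stars and special trees -/

section Criteria

variable {V : Type*} {H : SimpleGraph V}

theorem mem_of_reachable {T : Set V} (hT : ∀ u ∈ T, ∀ w, H.Adj u w → w ∈ T) {a v : V}
    (h : H.Reachable a v) (ha : a ∈ T) : v ∈ T := by
  obtain ⟨p⟩ := h
  induction p with
  | nil => exact ha
  | cons hadj p ih => exact ih (hT _ ha _ hadj)

theorem reachable_of_forall_adj {W : Type*} {R : SimpleGraph W} {φ : W → V}
    (h : ∀ a b, R.Adj a b → H.Reachable (φ a) (φ b)) {a b : W} (hab : R.Reachable a b) :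
    H.Reachable (φ a) (φ b) := by
  obtain ⟨p⟩ := hab
  induction p with
  | nil => exact .refl _
  | cons hadj p ih => exact (h _ _ hadj).trans ih

theorem nonempty_iso_of_injective {X : Type*} {T : SimpleGraph X} {c : H.ConnectedComponent}
    {ψ : X → V} (hinj : Function.Injective ψ) (hrange : ∀ v, v ∈ c.supp ↔ ∃ x, ψ x = v)
    (hadj : ∀ x y, H.Adj (ψ x) (ψ y) ↔ T.Adj x y) : Nonempty (c.toSimpleGraph ≃g T) := by
  let e : X ≃ c.supp := Equiv.ofBijective (fun x => ⟨ψ x, (hrange _).2 ⟨x, rfl⟩⟩)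
    ⟨fun x y h => hinj (congrArg Subtype.val h), fun v => by
      obtain ⟨x, hx⟩ := (hrange v.1).1 v.2
      exact ⟨x, Subtype.ext hx⟩⟩
  have he : T ≃g c.toSimpleGraph := ⟨e, fun {x y} => hadj x y⟩
  exact ⟨he.symm⟩

theorem isSmallStar_of_center [Finite V] {k : ℕ} {a : V} (hne : (H.neighborSet a).Nonempty)
    (hk : (H.neighborSet a).ncard ≤ k) (hb : ∀ b, H.Adj a b → ∀ w, H.Adj b w → w = a) :
    IsSmallStar k (H.connectedComponentMk a).toSimpleGraph := by
  let e : H.neighborSet a ≃ Fin (H.neighborSet a).ncard := Finite.equivFin _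
  refine ⟨_, (Set.ncard_pos).2 hne, hk, ?_⟩
  refine nonempty_iso_of_injective (ψ := Sum.elim (fun _ => a) fun i => (e.symm i).1) ?_ ?_ ?_
  · have hne' : ∀ i, a ≠ (e.symm i).1 := fun i => (e.symm i).2.ne
    rintro (i | i) (j | j) h
    · exact congrArg _ (Subsingleton.elim _ _)
    · exact absurd h (hne' j)
    · exact absurd h.symm (hne' i)
    · exact congrArg _ (e.symm.injective (Subtype.ext h))
  · intro v
    rw [SimpleGraph.ConnectedComponent.mem_supp_iff, SimpleGraph.ConnectedComponent.eq]
    constructor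
    · intro h
      have : v ∈ {v | v = a ∨ H.Adj a v} := by
        refine mem_of_reachable ?_ h.symm (Or.inl rfl)
        rintro u (rfl | hu) w hw
        · exact Or.inr hw
        · exact Or.inl (hb u hu w hw)
      rcases this with rfl | hv
      · exact ⟨Sum.inl 0, rfl⟩
      · exact ⟨Sum.inr (e ⟨v, hv⟩), by simp⟩
    · rintro ⟨i | i, rfl⟩
      · exact .refl _
      · exact (SimpleGraph.Adj.reachable (e.symm i).2).symm
  · have ha : ∀ i, H.Adj a (e.symm i).1 := fun i => (e.symm i).2
    rintro (i | i) (j | j)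
    · simp
    · simpa using ha j
    · simpa using (ha i).symm
    · simp only [Sum.elim_inr, completeBipartiteGraph_adj, Sum.isLeft_inr, Sum.isRight_inr]
      simp only [Bool.false_eq_true, false_and, and_false, or_self, iff_false]
      intro h
      exact (ha j).ne (hb _ (ha i) _ h).symm

/-- A description of a component `c` of `H` showing it to be special: `φ` enumerates the vertices
that do not subdivide an edge of the base tree, and `C` tells which of these are not leaves. -/
structure SpecialShape {W : Type*} (k : ℕ) (H : SimpleGraph V) (c : H.ConnectedComponent)
    (φ : W → V) (C : Set W) : Prop where
  inj : Function.Injective φ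
  mem : ∀ i, φ i ∈ c.supp
  leaf : ∀ i ∉ C, ∃ j ∈ C, ∀ w, H.Adj (φ i) w ↔ w = φ j
  mid : ∀ v ∈ c.supp, v ∉ Set.range φ →
    ∃ i ∈ C, ∃ j ∈ C, i ≠ j ∧ ∀ w, H.Adj v w ↔ w = φ i ∨ w = φ j
  indep : ∀ i ∈ C, ∀ j ∈ C, ¬ H.Adj (φ i) (φ j)
  count : ∀ i ∈ C, 2 * {j | j ∉ C ∧ H.Adj (φ i) (φ j)}.ncard +
    {v | v ∉ Set.range φ ∧ H.Adj (φ i) v}.ncard = 2 * k + 1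
  bridge : ∀ u ∈ c.supp, ∀ w, H.Adj u w → H.IsBridge s(u, w)

/-- Undo the subdivision of edges by the vertices outside the range of `φ`. -/
def contract {W : Type*} (H : SimpleGraph V) (φ : W → V) : SimpleGraph W where
  Adj i j := i ≠ j ∧ (H.Adj (φ i) (φ j) ∨ ∃ v ∉ Set.range φ, H.Adj v (φ i) ∧ H.Adj v (φ j))
  symm := ⟨fun _ _ h => ⟨h.1.symm, h.2.imp (fun h => h.symm) fun ⟨v, hv, h1, h2⟩ => ⟨v, hv, h2, h1⟩⟩⟩
  loopless := ⟨fun _ h => h.1 rfl⟩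

namespace SpecialShape

variable {W : Type*} {k : ℕ} {c : H.ConnectedComponent} {φ : W → V} {C : Set W}

theorem mem_supp_of_adj (_ : SpecialShape k H c φ C) {u w : V} (hu : u ∈ c.supp) (h : H.Adj u w) :
    w ∈ c.supp := c.mem_supp_of_adj_mem_supp hu h

theorem mid_adj (h : SpecialShape k H c φ C) {v : V} {i : W} (hv : v ∉ Set.range φ)
    (hi : H.Adj v (φ i)) :
    i ∈ C ∧ ∃ j ∈ C, j ≠ i ∧ ∀ w, H.Adj v w ↔ w = φ i ∨ w = φ j := by
  obtain ⟨a, ha, b, hb, hab, hw⟩ := h.mid v (h.mem_supp_of_adj (h.mem i) hi.symm) hv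
  rcases (hw _).1 hi with h1 | h1
  · obtain rfl := h.inj h1
    exact ⟨ha, b, hb, hab.symm, hw⟩
  · obtain rfl := h.inj h1
    exact ⟨hb, a, ha, hab, fun w => by rw [hw, or_comm]⟩

/-- Two such vertices would close a 4-cycle through `φ i` and `φ j`, whose edges could not be
bridges. -/
theorem mid_unique (h : SpecialShape k H c φ C) {v v' : V} {i j : W} (hij : i ≠ j)
    (hv : v ∉ Set.range φ) (hv' : v' ∉ Set.range φ)
    (hi : H.Adj v (φ i)) (hj : H.Adj v (φ j)) (hi' : H.Adj v' (φ i)) (hj' : H.Adj v' (φ j)) :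
    v = v' := by
  by_contra hne
  have hb := h.bridge (φ i) (h.mem i) v hi.symm
  refine hb ?_
  have hφ : φ i ≠ φ j := fun e => hij (h.inj e)
  have hvi : ∀ l, φ l ≠ v := fun l e => hv ⟨l, e⟩
  have hvi' : ∀ l, φ l ≠ v' := fun l e => hv' ⟨l, e⟩
  have h1 : (H.deleteEdges {s(φ i, v)}).Adj (φ i) v' := by
    rw [SimpleGraph.deleteEdges_adj]
    refine ⟨hi'.symm, ?_⟩
    simp [Ne.symm hne, hvi]
  have h2 : (H.deleteEdges {s(φ i, v)}).Adj v' (φ j) := by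
    rw [SimpleGraph.deleteEdges_adj]
    refine ⟨hj', ?_⟩
    simp [hvi, hφ.symm]
  have h3 : (H.deleteEdges {s(φ i, v)}).Adj (φ j) v := by
    rw [SimpleGraph.deleteEdges_adj]
    refine ⟨hj.symm, ?_⟩
    simp [hvi, hφ.symm]
  exact (h1.reachable.trans h2.reachable).trans h3.reachable

theorem contract_adj_left (h : SpecialShape k H c φ C) {i : W} (hi : i ∉ C) (j : W) :
    (contract H φ).Adj i j ↔ H.Adj (φ i) (φ j) := by
  constructor
  · rintro ⟨-, h1 | ⟨v, hv, h1, -⟩⟩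
    · exact h1
    · exact absurd (h.mid_adj hv h1).1 hi
  · intro h1
    exact ⟨fun e => h1.ne (congrArg φ e), Or.inl h1⟩

theorem contract_adj_center (h : SpecialShape k H c φ C) {i j : W} (hi : i ∈ C) (hj : j ∈ C) :
    (contract H φ).Adj i j ↔ i ≠ j ∧ ∃ v ∉ Set.range φ, H.Adj v (φ i) ∧ H.Adj v (φ j) := by
  simp only [contract, h.indep i hi j hj, false_or]

theorem ncard_center (h : SpecialShape k H c φ C) {i : W} (hi : i ∈ C) :
    {j | j ∈ C ∧ (contract H φ).Adj i j}.ncard = {v | v ∉ Set.range φ ∧ H.Adj (φ i) v}.ncard := by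
  symm
  have key : ∀ v ∈ {v | v ∉ Set.range φ ∧ H.Adj (φ i) v}, ∃ j ∈ C, j ≠ i ∧ H.Adj v (φ j) := by
    rintro v ⟨hv, hadj⟩
    obtain ⟨-, j, hj, hji, hw⟩ := h.mid_adj hv hadj.symm
    exact ⟨j, hj, hji, (hw _).2 (Or.inr rfl)⟩
  choose f hfC hfi hfa using key
  refine Set.ncard_congr f ?_ ?_ ?_
  · intro v hv
    exact ⟨hfC v hv, (h.contract_adj_center hi (hfC v hv)).2
      ⟨(hfi v hv).symm, v, hv.1, hv.2.symm, hfa v hv⟩⟩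
  · intro v w hv hw e
    refine h.mid_unique (hfi v hv).symm hv.1 hw.1 hv.2.symm (hfa v hv) hw.2.symm ?_
    rw [e]; exact hfa w hw
  · rintro j ⟨hj, hadj⟩
    obtain ⟨hne, v, hv, h1, h2⟩ := (h.contract_adj_center hi hj).1 hadj
    refine ⟨v, ⟨hv, h1.symm⟩, ?_⟩
    obtain ⟨-, l, hl, hli, hw⟩ := h.mid_adj hv h1
    have e1 : l = j := by
      rcases (hw _).1 h2 with e | e
      · exact absurd (h.inj e).symm hne
      · exact (h.inj e).symm
    rcases (hw _).1 (hfa v ⟨hv, h1.symm⟩) with e | e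
    · exact absurd (h.inj e) (hfi v ⟨hv, h1.symm⟩)
    · rw [h.inj e, e1]

theorem leafNeighbors_eq (h : SpecialShape k H c φ C) (i : W) :
    {j | j ∉ C ∧ (contract H φ).Adj i j} = {j | j ∉ C ∧ H.Adj (φ i) (φ j)} := by
  ext j
  simp only [Set.mem_ofPred_eq, and_congr_right_iff]
  intro hj
  rw [SimpleGraph.adj_comm, h.contract_adj_left hj, SimpleGraph.adj_comm]

/-- The contracted degree of `i ∈ C` is a sum `l + d` with `2 * l + d = 2 * k + 1`. It equals `1`
only if `k = 0`. -/
theorem leaves_contract [Finite W] (h : SpecialShape k H c φ C) (hk : 1 ≤ k) :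
    leaves (contract H φ) = Cᶜ := by
  ext i
  simp only [leaves, Set.mem_ofPred_eq, Set.mem_compl_iff]
  constructor
  · intro h1 hi
    have h2 := h.count i hi
    rw [← h.leafNeighbors_eq, ← h.ncard_center hi] at h2
    have h3 : (contract H φ).neighborSet i =
        {j | j ∉ C ∧ (contract H φ).Adj i j} ∪ {j | j ∈ C ∧ (contract H φ).Adj i j} := by
      ext j; simp only [SimpleGraph.mem_neighborSet, Set.mem_union, Set.mem_ofPred_eq]; tauto
    rw [h3, Set.ncard_union_eq ?_ (Set.toFinite _) (Set.toFinite _)] at h1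
    · omega
    · rw [Set.disjoint_left]
      exact fun j h4 h5 => h4.1 h5.1
  · intro hi
    obtain ⟨j, hj, hw⟩ := h.leaf i hi
    rw [Set.ncard_eq_one]
    refine ⟨j, ?_⟩
    ext l
    rw [SimpleGraph.mem_neighborSet, h.contract_adj_left hi, hw, Set.mem_singleton_iff,
      h.inj.eq_iff]

theorem mem_center [Finite W] (h : SpecialShape k H c φ C) (hk : 1 ≤ k)
    (x : ↥(leaves (contract H φ))ᶜ) : x.1 ∈ C := by
  by_contra hx
  exact x.2 ((Set.ext_iff.1 (h.leaves_contract hk) x.1).2 hx)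

theorem coreDegree_eq [Finite W] (h : SpecialShape k H c φ C) (hk : 1 ≤ k)
    (x : ↥(leaves (contract H φ))ᶜ) :
    coreDegree (contract H φ) x = {v | v ∉ Set.range φ ∧ H.Adj (φ x) v}.ncard := by
  have hL := h.leaves_contract hk
  have hx := h.mem_center hk x
  rw [coreDegree, ← h.ncard_center hx, ← Set.ncard_image_of_injective _ Subtype.val_injective]
  congr 1
  ext j
  simp only [Set.mem_image, SimpleGraph.mem_neighborSet, SimpleGraph.comap_adj, Set.mem_ofPred_eq]
  constructor
  · rintro ⟨y, hy, rfl⟩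
    exact ⟨h.mem_center hk y, hy⟩
  · rintro ⟨hj, hadj⟩
    exact ⟨⟨j, by rw [hL]; simpa using hj⟩, hadj, rfl⟩

theorem leafCount_eq [Finite W] (h : SpecialShape k H c φ C) (hk : 1 ≤ k)
    (x : ↥(leaves (contract H φ))ᶜ) :
    leafCount (contract H φ) x = {j | j ∉ C ∧ H.Adj (φ x) (φ j)}.ncard := by
  rw [leafCount, ← h.leafNeighbors_eq]
  congr 1
  ext j
  have hj := Set.ext_iff.1 (h.leaves_contract hk) j
  simp only [Set.mem_inter_iff, hj, SimpleGraph.mem_neighborSet, Set.mem_compl_iff, Set.mem_ofPred_eq]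
  tauto

theorem count_eq [Finite W] (h : SpecialShape k H c φ C) (hk : 1 ≤ k)
    (x : ↥(leaves (contract H φ))ᶜ) :
    2 * leafCount (contract H φ) x + coreDegree (contract H φ) x = 2 * k + 1 := by
  rw [h.leafCount_eq hk, h.coreDegree_eq hk]
  exact h.count x (h.mem_center hk x)

theorem connected (h : SpecialShape k H c φ C) : (contract H φ).Connected := by
  have hne : Nonempty W := by
    obtain ⟨v, hv⟩ := c.nonempty_supp
    by_cases hr : v ∈ Set.range φ
    · exact ⟨hr.choose⟩
    · obtain ⟨i, -⟩ := h.mid v hv hr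
      exact ⟨i⟩
  refine ⟨fun i j => ?_⟩
  let T : Set V := {v | (∃ l, φ l = v ∧ (contract H φ).Reachable i l) ∨
    (v ∉ Set.range φ ∧ ∃ l, H.Adj v (φ l) ∧ (contract H φ).Reachable i l)}
  have hT : ∀ u ∈ T, ∀ w, H.Adj u w → w ∈ T := by
    rintro u (⟨l, rfl, hl⟩ | ⟨hu, l, hul, hl⟩) w hw
    · by_cases hr : w ∈ Set.range φ
      · obtain ⟨n, rfl⟩ := hr
        refine Or.inl ⟨n, rfl, hl.trans (SimpleGraph.Adj.reachable ?_)⟩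
        exact ⟨fun e => hw.ne (congrArg φ e), Or.inl hw⟩
      · exact Or.inr ⟨hr, l, hw.symm, hl⟩
    · obtain ⟨hlC, n, hn, hnl, hw'⟩ := h.mid_adj hu hul
      rcases (hw' w).1 hw with rfl | rfl
      · exact Or.inl ⟨l, rfl, hl⟩
      · exact Or.inl ⟨n, rfl, hl.trans (SimpleGraph.Adj.reachable
          ⟨hnl.symm, Or.inr ⟨u, hu, hul, hw⟩⟩)⟩
  have hreach : H.Reachable (φ i) (φ j) := c.reachable_of_mem_supp (h.mem i) (h.mem j)
  rcases mem_of_reachable hT hreach (Or.inl ⟨i, rfl, .refl _⟩) with ⟨l, hl, hr⟩ | ⟨hn, -⟩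
  · rwa [h.inj hl] at hr
  · exact absurd ⟨j, rfl⟩ hn

/-- A path in the contraction that bypasses an edge lifts to a path in `H` that bypasses a
corresponding edge, which is a bridge. -/
theorem isAcyclic (h : SpecialShape k H c φ C) : (contract H φ).IsAcyclic := by
  rw [SimpleGraph.isAcyclic_iff_forall_adj_isBridge]
  intro i j hij hreach
  have hne := hij.ne
  rcases hij.2 with hadj | ⟨v, hv, hvi, hvj⟩
  · refine h.bridge _ (h.mem i) _ hadj (reachable_of_forall_adj ?_ hreach)
    intro a b hab
    rw [SimpleGraph.deleteEdges_adj] at hab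
    obtain ⟨⟨-, hab1 | ⟨v, hv, hva, hvb⟩⟩, hab2⟩ := hab
    · refine SimpleGraph.Adj.reachable ?_
      rw [SimpleGraph.deleteEdges_adj]
      simp only [Set.mem_singleton_iff, Sym2.eq_iff, h.inj.eq_iff] at hab2 ⊢
      exact ⟨hab1, hab2⟩
    · have hvi : ∀ l, v ≠ φ l := fun l e => hv ⟨l, e.symm⟩
      have key : ∀ l, H.Adj v (φ l) → (H.deleteEdges {s(φ i, φ j)}).Adj v (φ l) := by
        intro l hl
        rw [SimpleGraph.deleteEdges_adj]
        simp [hvi, hl]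
      exact (key a hva).symm.reachable.trans (key b hvb).reachable
  · have hvφ : ∀ l, φ l ≠ v := fun l e => hv ⟨l, e⟩
    have hreach' : (contract H φ).deleteEdges {s(i, j)} |>.Reachable i j := hreach
    refine h.bridge _ (h.mem i) _ hvi.symm (SimpleGraph.Reachable.trans
      (reachable_of_forall_adj (H := H.deleteEdges {s(φ i, v)}) (φ := φ) ?_ hreach')
      (SimpleGraph.Adj.reachable ?_))
    · intro a b hab
      rw [SimpleGraph.deleteEdges_adj] at hab
      obtain ⟨⟨hab0, hab1 | ⟨w, hw, hwa, hwb⟩⟩, hab2⟩ := hab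
      · refine SimpleGraph.Adj.reachable ?_
        rw [SimpleGraph.deleteEdges_adj]
        simp [hvφ, hab1]
      -- The vertex `v` subdivides only the edge `ij`, which has been deleted, so the lift never
      -- needs `v`.
      · by_cases hwv : w = v
        · subst hwv
          exfalso
          obtain ⟨-, l, -, hli, hl⟩ := h.mid_adj hw hvi
          have e1 := (hl _).1 hvj
          have e2 := (hl _).1 hwa
          have e3 := (hl _).1 hwb
          simp only [h.inj.eq_iff] at e1 e2 e3
          simp only [Set.mem_singleton_iff, Sym2.eq_iff] at hab2
          grind
        · have key : ∀ l, H.Adj w (φ l) → (H.deleteEdges {s(φ i, v)}).Adj w (φ l) := by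
            intro l hl
            rw [SimpleGraph.deleteEdges_adj]
            simp [hvφ, hl, hwv]
          exact (key a hwa).symm.reachable.trans (key b hwb).reachable
    · rw [SimpleGraph.deleteEdges_adj]
      simp [hvφ, hvj.symm, h.inj.eq_iff, hne.symm]

theorem isBaseTree [Finite W] (h : SpecialShape k H c φ C) (hk : 1 ≤ k) :
    IsBaseTree k (contract H φ) where
  isTree := ⟨h.connected, h.isAcyclic⟩
  coreDegree_mem x := by
    have := h.count_eq hk x
    exact ⟨k - leafCount (contract H φ) x, by omega, by omega⟩
  two_mul_leafCount_add_le x := (h.count_eq hk x).le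

theorem nonempty_iso [Finite W] (h : SpecialShape k H c φ C) (hk : 1 ≤ k) :
    Nonempty (c.toSimpleGraph ≃g derivedTree k (contract H φ)) := by
  have hL := h.leaves_contract hk
  have hC : ∀ x : ↥(leaves (contract H φ))ᶜ, x.1 ∈ C := h.mem_center hk
  have hmid : ∀ e : ↥(core (contract H φ)).edgeSet, ∃ v, v ∉ Set.range φ ∧
      ∀ w, H.Adj v w ↔ ∃ x ∈ e.1, φ x.1 = w := by
    rintro ⟨e, he⟩
    induction e with
    | _ x y =>
      have hadj : (contract H φ).Adj x.1 y.1 := he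
      obtain ⟨hne, v, hv, h1, h2⟩ := (h.contract_adj_center (hC x) (hC y)).1 hadj
      refine ⟨v, hv, fun w => ?_⟩
      obtain ⟨-, l, -, hl, hw⟩ := h.mid_adj hv h1
      have hly : l = y.1 := by
        rcases (hw _).1 h2 with e | e
        · exact absurd (h.inj e).symm hne
        · exact (h.inj e).symm
      rw [hw, hly]
      simp [eq_comm]
  choose mid hmr hma using hmid
  -- Equality in the count, `2 * l + (2 * r + 1) = 2 * k + 1`, gives `k - r - l = 0`.
  have hp : IsEmpty (Σ x, Fin (pendantCount k (contract H φ) x)) := by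
    refine isEmpty_sigma.2 fun x => ?_
    have := h.count_eq hk x
    have h0 : pendantCount k (contract H φ) x = 0 := by
      rw [pendantCount]; omega
    rw [h0]; infer_instance
  refine nonempty_iso_of_injective
    (ψ := Sum.elim φ (Sum.elim mid hp.elim)) ?_ ?_ ?_
  · rintro (i | e | p) (j | f | q) hψ
    all_goals try exact hp.elim ‹Σ x, Fin (pendantCount k (contract H φ) x)›
    · exact congrArg _ (h.inj hψ)
    · exact absurd ⟨i, hψ⟩ (hmr f)
    · exact absurd ⟨j, hψ.symm⟩ (hmr e)
    · have hψ' : mid e = mid f := hψ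
      refine congrArg _ (congrArg _ (Subtype.ext (Sym2.ext fun x => ?_)))
      have h1 := hma e (φ x)
      have h2 := hma f (φ x)
      rw [hψ', h2] at h1
      have key : ∀ g : ↥(core (contract H φ)).edgeSet, (∃ y ∈ g.1, φ y.1 = φ x.1) ↔ x ∈ g.1 := by
        intro g
        constructor
        · rintro ⟨y, hy, e⟩
          rwa [← Subtype.ext (h.inj e)]
        · exact fun hx => ⟨x, hx, rfl⟩
      rw [key, key] at h1
      exact h1.symm
  · intro v
    constructor
    · intro hv
      by_cases hr : v ∈ Set.range φ
      · obtain ⟨i, rfl⟩ := hr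
        exact ⟨Sum.inl i, rfl⟩
      · obtain ⟨i, hi, j, hj, hij, hw⟩ := h.mid v hv hr
        have hvi := (hw _).2 (Or.inl rfl)
        have hvj := (hw _).2 (Or.inr rfl)
        have hadj : (contract H φ).Adj i j := ⟨hij, Or.inr ⟨v, hr, hvi, hvj⟩⟩
        have hi' : i ∈ (leaves (contract H φ))ᶜ := by rw [hL]; simpa using hi
        have hj' : j ∈ (leaves (contract H φ))ᶜ := by rw [hL]; simpa using hj
        let e : ↥(core (contract H φ)).edgeSet := ⟨s(⟨i, hi'⟩, ⟨j, hj'⟩), hadj⟩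
        refine ⟨Sum.inr (Sum.inl e), ?_⟩
        refine h.mid_unique hij (hmr e) hr ((hma e _).2 ?_) ((hma e _).2 ?_) hvi hvj
        · exact ⟨⟨i, hi'⟩, Sym2.mem_mk_left _ _, rfl⟩
        · exact ⟨⟨j, hj'⟩, Sym2.mem_mk_right _ _, rfl⟩
    · rintro ⟨i | e | p, rfl⟩
      · exact h.mem i
      · obtain ⟨e, he⟩ := e
        induction e with
        | _ x y =>
          exact h.mem_supp_of_adj (h.mem x)
            ((hma ⟨s(x, y), he⟩ (φ x)).2 ⟨x, Sym2.mem_mk_left _ _, rfl⟩).symm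
      · exact hp.elim p
  · have hmm : ∀ i e, H.Adj (φ i) (mid e) ↔ ∃ x ∈ e.1, x.1 = i := by
      intro i e
      rw [SimpleGraph.adj_comm, hma]
      simp only [h.inj.eq_iff]
    rintro (i | e | p) (j | f | q)
    all_goals try exact hp.elim ‹Σ x, Fin (pendantCount k (contract H φ) x)›
    · simp only [derivedTree, SimpleGraph.fromRel_adj, Sum.elim_inl, hL, Set.mem_compl_iff]
      constructor
      · intro hadj
        have hne : i ≠ j := fun e => hadj.ne (congrArg φ e)
        refine ⟨fun e => hne (Sum.inl_injective e), Or.inl ⟨⟨hne, Or.inl hadj⟩, ?_⟩⟩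
        by_contra! hcon
        exact h.indep i hcon.1 j hcon.2 hadj
      · have key : ∀ i j, (contract H φ).Adj i j ∧ (i ∉ C ∨ j ∉ C) → H.Adj (φ i) (φ j) := by
          rintro i j ⟨hadj, hi | hj⟩
          · exact (h.contract_adj_left hi j).1 hadj
          · exact ((h.contract_adj_left hj i).1 hadj.symm).symm
        rintro ⟨-, h1 | h1⟩
        · exact key _ _ h1
        · exact (key _ _ h1).symm
    · simp only [derivedTree, SimpleGraph.fromRel_adj, Sum.elim_inl, Sum.elim_inr, hmm]
      simp
    · rw [SimpleGraph.adj_comm]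
      simp only [derivedTree, SimpleGraph.fromRel_adj, Sum.elim_inl, Sum.elim_inr, hmm]
      simp
    · simp only [derivedTree, SimpleGraph.fromRel_adj, Sum.elim_inl, Sum.elim_inr, hma]
      simp only [or_self, and_false, iff_false]
      rintro ⟨x, -, hx⟩
      exact hmr f ⟨_, hx⟩

theorem isSpecialTree [Finite W] (h : SpecialShape k H c φ C) (hk : 1 ≤ k) :
    IsSpecialTree k c.toSimpleGraph := by
  let e := Finite.equivFin W
  have h' : SpecialShape k H c (φ ∘ e.symm) (e.symm ⁻¹' C) := by
    have hr : Set.range (φ ∘ e.symm) = Set.range φ := e.symm.surjective.range_comp φ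
    refine ⟨h.inj.comp e.symm.injective, fun i => h.mem _, fun i hi => ?_, ?_,
      fun i hi j hj => h.indep _ hi _ hj, fun i hi => ?_, h.bridge⟩
    · obtain ⟨j, hj, hw⟩ := h.leaf _ hi
      exact ⟨e j, by simpa using hj, by simpa using hw⟩
    · rw [hr]
      intro v hv hvr
      obtain ⟨i, hi, j, hj, hij, hw⟩ := h.mid v hv hvr
      exact ⟨e i, by simpa using hi, e j, by simpa using hj, by simpa using hij, by simpa using hw⟩
    · rw [hr, ← h.count _ hi, ← Set.ncard_image_of_injective _ e.symm.injective]
      congr 3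
      ext j
      simp only [Set.mem_image, Set.mem_preimage, Set.mem_ofPred_eq, Function.comp]
      constructor
      · rintro ⟨l, hl, rfl⟩; exact hl
      · exact fun hj => ⟨e j, by simpa using hj, by simp⟩
  exact ⟨_, _, h'.isBaseTree hk, h'.nonempty_iso hk⟩

end SpecialShape

end Criteria

/-! ### Covering by stars with at most two edges -/

section Stars

variable {V : Type*}

/-- `a` is adjacent to between `1` and `k` vertices, and none of these has another neighbour. -/
structure IsStarCenter (k : ℕ) (H : SimpleGraph V) (a : V) : Prop where
  nonempty : (H.neighborSet a).Nonempty
  ncard_le : (H.neighborSet a).ncard ≤ k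
  eq_of_adj : ∀ b, H.Adj a b → ∀ w, H.Adj b w → w = a

theorem IsStarCenter.congr {k : ℕ} {H K : SimpleGraph V} {a : V} (h : IsStarCenter k K a)
    {T : Set V} (hT : ∀ u ∈ T, ∀ w, H.Adj u w ↔ K.Adj u w) (hK : ∀ u ∈ T, ∀ w, K.Adj u w → w ∈ T)
    (ha : a ∈ T) : IsStarCenter k H a := by
  have hn : H.neighborSet a = K.neighborSet a := Set.ext fun w => hT a ha w
  refine ⟨hn ▸ h.nonempty, hn ▸ h.ncard_le, fun b hb w hw => ?_⟩
  have hb' := (hT a ha b).1 hb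
  exact h.eq_of_adj b hb' w ((hT b (hK a ha b hb') w).1 hw)

theorem IsStarCenter.isSmallStar [Finite V] {k : ℕ} {H : SimpleGraph V} {a v : V}
    (h : IsStarCenter k H a) (hv : v = a ∨ H.Adj a v) :
    IsSmallStar k (H.connectedComponentMk v).toSimpleGraph := by
  have : H.connectedComponentMk v = H.connectedComponentMk a := by
    rcases hv with rfl | hv
    · rfl
    · exact SimpleGraph.ConnectedComponent.sound hv.symm.reachable
  rw [this]
  exact isSmallStar_of_center h.nonempty h.ncard_le h.eq_of_adj

/-- An injection of `U` into itself along edges of `G` yields a cover of `U` by stars with at most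
two edges. -/
theorem exists_star_cover [Finite V] {G : SimpleGraph V} {U : Set V} {f : V → V}
    (hf : ∀ u ∈ U, f u ∈ U ∧ G.Adj u (f u)) (hinj : Set.InjOn f U) :
    ∃ P ≤ G, (∀ u w, P.Adj u w → u ∈ U) ∧
      ∀ u ∈ U, ∃ a ∈ U, (u = a ∨ P.Adj a u) ∧ IsStarCenter 2 P a := by
  let Q : SimpleGraph V := SimpleGraph.fromRel fun u w => u ∈ U ∧ w = f u
  have hQG : Q ≤ G := by
    rintro u w ⟨-, ⟨hu, rfl⟩ | ⟨hw, rfl⟩⟩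
    · exact (hf u hu).2
    · exact (hf w hw).2.symm
  have hQU : ∀ u w, Q.Adj u w → u ∈ U := by
    rintro u w ⟨-, ⟨hu, rfl⟩ | ⟨hw, rfl⟩⟩
    · exact hu
    · exact (hf w hw).1
  have hQ2 : ∀ u, (Q.neighborSet u).ncard ≤ 2 := by
    intro u
    have hsub : Q.neighborSet u ⊆ {f u} ∪ {w | w ∈ U ∧ u = f w} := by
      rintro w ⟨-, ⟨-, hw⟩ | hw⟩
      · exact Or.inl hw
      · exact Or.inr hw
    have h1 : {w | w ∈ U ∧ u = f w}.ncard ≤ 1 := by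
      rw [Set.ncard_le_one]
      rintro a ⟨ha, rfl⟩ b ⟨hb, hab⟩
      exact hinj ha hb hab
    calc _ ≤ _ := Set.ncard_le_ncard hsub (Set.toFinite _)
      _ ≤ _ := Set.ncard_union_le _ _
      _ ≤ 2 := by rw [Set.ncard_singleton]; omega
  -- The edges `u – f u` give degrees at most two. In a minimal subgraph still covering `U`, every
  -- edge has an end of degree one, since otherwise it could be removed; hence all components are
  -- stars.
  obtain ⟨P, ⟨hPQ, hPne⟩, hmin⟩ := WellFounded.has_min (wellFounded_lt (α := SimpleGraph V))
    {P | P ≤ Q ∧ ∀ u ∈ U, ∃ w, P.Adj u w}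
    ⟨Q, le_rfl, fun u hu => ⟨f u, (hf u hu).2.ne, Or.inl ⟨hu, rfl⟩⟩⟩
  have hedge : ∀ u w, P.Adj u w →
      (∀ w', P.Adj u w' → w' = w) ∨ (∀ u', P.Adj w u' → u' = u) := by
    intro u w huw
    by_contra! hcon
    obtain ⟨⟨w', hw', hww'⟩, u', hu', huu'⟩ := hcon
    refine hmin (P.deleteEdges {s(u, w)})
      ⟨(SimpleGraph.deleteEdges_le _).trans hPQ, fun z hz => ?_⟩
      (lt_of_le_of_ne (SimpleGraph.deleteEdges_le _) fun e => ?_)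
    · simp only [SimpleGraph.deleteEdges_adj, Set.mem_singleton_iff, Sym2.eq_iff]
      by_cases h1 : z = u
      · exact ⟨w', h1 ▸ hw', by rintro (h | h) <;> simp_all⟩
      · by_cases h2 : z = w
        · exact ⟨u', h2 ▸ hu', by rintro (h | h) <;> simp_all⟩
        · obtain ⟨t, ht⟩ := hPne z hz
          exact ⟨t, ht, by tauto⟩
    · rw [← e] at huw
      simp at huw
  have hPU : ∀ u w, P.Adj u w → u ∈ U := fun u w h => hQU u w (hPQ h)
  have hP2 : ∀ u, (P.neighborSet u).ncard ≤ 2 := fun u =>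
    (Set.ncard_le_ncard (fun w hw => hPQ hw) (Set.toFinite _)).trans (hQ2 u)
  refine ⟨P, hPQ.trans hQG, hPU, fun u hu => ?_⟩
  by_cases hc : ∀ b, P.Adj u b → ∀ w, P.Adj b w → w = u
  · exact ⟨u, hu, Or.inl rfl, hPne u hu, hP2 u, hc⟩
  · push Not at hc
    obtain ⟨b, hub, u', hbu', hne⟩ := hc
    refine ⟨b, hPU _ _ hub.symm, Or.inr hub.symm, ⟨u, hub.symm⟩, hP2 b, fun c hbc w hw => ?_⟩
    rcases hedge b c hbc with h1 | h1
    · exact absurd ((h1 u' hbu').trans (h1 u hub.symm).symm) hne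
    · exact h1 w hw

end Stars

/-! ### Components of the support of a minimal assignment -/

namespace IsMinAssignment

variable {V : Type*} [Fintype V] {r : V → V → Prop} {I S : Finset V} {N k : ℕ} {x : V → V → ℕ}

theorem exists_ne_zero (h : IsMinAssignment r I S N x) {v : V} (hv : v ∈ I) :
    ∃ s, x v s ≠ 0 := by
  by_contra! hcon
  have := h.row v hv
  simp [hcon] at this

theorem mem_union (h : IsMinAssignment r I S N x) {v w : V} (ha : (supportGraph x).Adj v w) :
    v ∈ I ∨ v ∈ S := by
  rcases h.mem_of_adj ha with h1 | h1
  · exact Or.inl h1.1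
  · exact Or.inr h1.1

theorem sum_eq (h : IsMinAssignment r I S N x) (s : V) :
    ∑ v, x v s = 2 * #{v | x v s = 2} + #{v | x v s = 1} := by
  rw [card_filter, card_filter, mul_sum, ← sum_add_distrib]
  refine sum_congr rfl fun v _ => ?_
  have : x v s ≤ 2 := by
    by_cases hv : v ∈ I
    · exact h.le_two hv s
    · have : x v s = 0 := by
        by_contra h0
        exact hv (h.supp _ _ h0).1
      omega
  interval_cases x v s <;> simp

/-- All amounts received by `s` are `2`, so its load is twice its degree; being at most `2 * k + 1`,
it bounds the degree by `k`. -/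
theorem isStarCenter_right (h : IsMinAssignment r I S (2 * k + 1) x) {s : V} (hs : s ∈ S)
    (hx : ∀ u, x u s ≠ 1) : IsStarCenter k (supportGraph x) s := by
  have hsum := h.sum_eq s
  have h1 : #{v | x v s = 1} = 0 := by simp [hx]
  have hpos := h.load_pos s hs
  have hle := h.load_le s hs
  have htwo : ∀ u, x u s ≠ 0 → x u s = 2 := by
    intro u hu
    have := h.le_two (h.supp _ _ hu).1 s
    have := hx u
    omega
  have hn : (supportGraph x).neighborSet s = ({v | x v s = 2} : Finset V) := by
    ext v
    rw [SimpleGraph.mem_neighborSet, SimpleGraph.adj_comm, h.adj_right hs]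
    simp only [coe_filter, mem_univ, true_and, Set.mem_ofPred_eq]
    exact ⟨htwo v, fun e => by omega⟩
  refine ⟨?_, ?_, fun b hb w hw => ?_⟩
  · rw [hn, coe_nonempty, ← card_pos]; omega
  · rw [hn, Set.ncard_coe_finset]; omega
  · have hb' := (h.adj_right hs).1 hb.symm
    rw [h.adj_left (h.supp _ _ hb').1] at hw
    exact h.eq_of_eq_two (htwo b hb') hw

theorem isStarCenter_left (h : IsMinAssignment r I S N x) {u s t : V} (hst : s ≠ t)
    (hs : x u s ≠ 0) (ht : x u t ≠ 0) (hs1 : ∑ v, x v s = 1) (ht1 : ∑ v, x v t = 1) :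
    IsStarCenter 2 (supportGraph x) u := by
  classical
  obtain ⟨-, -, h3⟩ := h.add_eq_two hst hs ht
  have hu := (h.supp _ _ hs).1
  have hn : ∀ w, (supportGraph x).Adj u w → w = s ∨ w = t := by
    intro w hw
    rw [h.adj_left hu] at hw
    by_contra! hcon
    exact hw (h3 w hcon.1 hcon.2)
  refine ⟨⟨s, (h.adj_left hu).2 hs⟩, ?_, fun b hb w hw => ?_⟩
  · exact (Set.ncard_le_ncard (t := {s, t}) (fun w hw => hn w hw) (Set.toFinite _)).trans
      (Set.ncard_pair hst).le
  · have hub := (h.adj_left hu).1 hb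
    have hb1 : ∑ v, x v b = 1 := by rcases hn b hb with rfl | rfl <;> assumption
    have hwb := (h.adj_right (h.supp _ _ hub).2.1).1 hw.symm
    by_contra hne
    rw [← add_sum_erase _ _ (mem_univ u),
      ← add_sum_erase _ _ (mem_erase.2 ⟨hne, mem_univ w⟩)] at hb1
    omega

/-- A connected component on which all loads are maximal is a special tree. -/
theorem isSpecialTree (h : IsMinAssignment r I S (2 * k + 1) x) (hk : 1 ≤ k)
    {H : SimpleGraph V} (hH : ∀ u, u ∈ I ∨ u ∈ S → ∀ w, H.Adj u w ↔ (supportGraph x).Adj u w)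
    {s : V} (hs : s ∈ S) (hload : ∑ u, x u s = 2 * k + 1) :
    IsSpecialTree k (H.connectedComponentMk s).toSimpleGraph := by
  set c := H.connectedComponentMk s
  have hd := disjoint_left.1 h.disj
  have hI : ∀ v ∈ I, ∀ w, H.Adj v w ↔ x v w ≠ 0 := fun v hv w => by
    rw [hH v (Or.inl hv), h.adj_left hv]
  have hS : ∀ t ∈ S, ∀ w, H.Adj t w ↔ x w t ≠ 0 := fun t ht w => by
    rw [hH t (Or.inr ht), SimpleGraph.adj_comm, h.adj_right ht]
  -- Maximal load spreads through the component: a split vertex with one neighbour of load `2 * k +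
  -- 1` has both of that load, by `load_of_ne` and `2 * k + 1 ≠ 1`.
  have hc : ∀ v ∈ c.supp, (v ∈ S ∧ ∑ u, x u v = 2 * k + 1) ∨
      (v ∈ I ∧ ∀ t, x v t ≠ 0 → ∑ u, x u t = 2 * k + 1) := by
    intro v hv
    have hreach : H.Reachable s v := (SimpleGraph.ConnectedComponent.exact hv).symm
    refine mem_of_reachable (T := {v | (v ∈ S ∧ ∑ u, x u v = 2 * k + 1) ∨
      (v ∈ I ∧ ∀ t, x v t ≠ 0 → ∑ u, x u t = 2 * k + 1)}) ?_ hreach (Or.inl ⟨hs, hload⟩)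
    rintro u (⟨hu, hul⟩ | ⟨hu, hul⟩) w hw
    · rw [hS u hu] at hw
      refine Or.inr ⟨(h.supp _ _ hw).1, fun t ht => ?_⟩
      by_cases htu : t = u
      · rw [htu, hul]
      · rcases h.load_of_ne (by omega) htu ht hw with h1 | h1 <;> omega
    · rw [hI u hu] at hw
      exact Or.inl ⟨(h.supp _ _ hw).2.1, hul w hw⟩
  have hcU : ∀ v ∈ c.supp, v ∈ I ∨ v ∈ S := fun v hv =>
    (hc v hv).elim (fun h => Or.inr h.1) fun h => Or.inl h.1
  -- The base tree lives on the vertices of `S` and the vertices of `I` giving both units to one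
  -- neighbour. The split vertices of `I` become the subdividing ones.
  let W := {w // w ∈ c.supp ∧ (w ∈ S ∨ ∃ t, x w t = 2)}
  have hadjc : ∀ {u w}, u ∈ c.supp → H.Adj u w → w ∈ c.supp := fun hu hw =>
    c.mem_supp_of_adj_mem_supp hu hw
  have hWr : ∀ v ∈ c.supp, v ∉ Set.range (Subtype.val : W → V) ↔
      v ∈ I ∧ ∀ t, x v t ≠ 2 := by
    intro v hv
    rw [Subtype.range_coe_subtype, Set.mem_ofPred_eq]
    push Not
    constructor
    · intro h1
      exact ⟨(hcU v hv).resolve_right (h1 hv).1, (h1 hv).2⟩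
    · exact fun h1 _ => ⟨hd h1.1, h1.2⟩
  have shape : SpecialShape k H c (Subtype.val : W → V) {i | i.1 ∈ S} := by
    refine ⟨Subtype.val_injective, fun i => i.2.1, ?_, ?_, ?_, ?_, ?_⟩
    · rintro ⟨v, hv, hv'⟩ (hvS : v ∉ S)
      obtain ⟨t, ht⟩ := hv'.resolve_left hvS
      have ht0 : x v t ≠ 0 := by omega
      obtain ⟨hvI, htS, -⟩ := h.supp _ _ ht0
      refine ⟨⟨t, hadjc hv ((hI v hvI t).2 ht0), Or.inl htS⟩, htS, fun w => ?_⟩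
      rw [hI v hvI]
      exact ⟨h.eq_of_eq_two ht, fun e => by rw [e]; exact ht0⟩
    · intro v hv hr
      obtain ⟨hvI, hv2⟩ := (hWr v hv).1 hr
      obtain ⟨a, ha⟩ := h.exists_ne_zero hvI
      have ha1 : x v a = 1 := by
        have := h.le_two hvI a
        have := hv2 a
        omega
      obtain ⟨b, hba, hb1⟩ := h.exists_other ha1
      have hb : x v b ≠ 0 := by omega
      have haS := (h.supp _ _ ha).2.1
      have hbS := (h.supp _ _ hb).2.1
      refine ⟨⟨a, hadjc hv ((hI v hvI a).2 ha), Or.inl haS⟩, haS,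
        ⟨b, hadjc hv ((hI v hvI b).2 hb), Or.inl hbS⟩, hbS,
        fun e => hba (congrArg Subtype.val e).symm, fun w => ?_⟩
      rw [hI v hvI]
      constructor
      · intro hw
        by_contra! hcon
        exact hw ((h.add_eq_two hba.symm ha hb).2.2 w hcon.1 hcon.2)
      · rintro (e | e) <;> rw [e] <;> assumption
    · rintro ⟨i, hi⟩ (hiS : i ∈ S) ⟨j, hj⟩ (hjS : j ∈ S) hadj
      rw [hS i hiS] at hadj
      exact hd (h.supp _ _ hadj).1 hjS
    · rintro ⟨i, hic, hi⟩ (hiS : i ∈ S)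
      have hl : ∑ u, x u i = 2 * k + 1 := by
        rcases hc i hic with h1 | h1
        · exact h1.2
        · exact absurd hiS (hd h1.1)
      rw [← hl, h.sum_eq, ← Set.ncard_image_of_injective _ Subtype.val_injective,
        ← Set.ncard_coe_finset, ← Set.ncard_coe_finset]
      congr 2
      · congr 1
        ext v
        simp only [Set.mem_image, Set.mem_ofPred_eq, coe_filter, mem_univ, true_and]
        constructor
        · rintro ⟨⟨j, hjc, hj⟩, ⟨hjS, hadj⟩, rfl⟩
          obtain ⟨t, ht⟩ := hj.resolve_left hjS
          rw [hS i hiS] at hadj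
          rw [h.eq_of_eq_two ht hadj]
          exact ht
        · intro hv
          have hv0 : x v i ≠ 0 := by omega
          have hadj := (hS i hiS v).2 hv0
          exact ⟨⟨v, hadjc hic hadj, Or.inr ⟨i, hv⟩⟩, ⟨hd (h.supp _ _ hv0).1, hadj⟩, rfl⟩
      · ext v
        simp only [Set.mem_ofPred_eq, coe_filter, mem_univ, true_and]
        constructor
        · rintro ⟨hr, hadj⟩
          obtain ⟨hvI, hv2⟩ := (hWr v (hadjc hic hadj)).1 hr
          have h0 := (hS i hiS v).1 hadj
          have := h.le_two hvI i
          have := hv2 i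
          omega
        · intro hv
          have hv0 : x v i ≠ 0 := by omega
          have hadj := (hS i hiS v).2 hv0
          refine ⟨(hWr v (hadjc hic hadj)).2 ⟨(h.supp _ _ hv0).1, fun t ht => ?_⟩, hadj⟩
          have := h.eq_of_eq_two ht hv0
          subst this
          omega
    · intro u hu w huw hreach
      have hadj := (hH u (hcU u hu) w).1 huw
      refine SimpleGraph.isAcyclic_iff_forall_adj_isBridge.1 h.isAcyclic hadj ?_
      have hreach' : (H.deleteEdges {s(u, w)}).Reachable u w := hreach
      refine (mem_of_reachable (T := {z | (z ∈ I ∨ z ∈ S) ∧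
        ((supportGraph x).deleteEdges {s(u, w)}).Reachable u z}) ?_ hreach'
        ⟨hcU u hu, .refl _⟩).2
      rintro z ⟨hz, hzr⟩ z' hzz'
      rw [SimpleGraph.deleteEdges_adj] at hzz'
      have hK := (hH z hz z').1 hzz'.1
      refine ⟨h.mem_union hK.symm, hzr.trans (SimpleGraph.Adj.reachable ?_)⟩
      rw [SimpleGraph.deleteEdges_adj]
      exact ⟨hK, hzz'.2⟩
  exact shape.isSpecialTree hk

theorem component (h : IsMinAssignment r I S (2 * k + 1) x) (hk : 2 ≤ k)
    {H : SimpleGraph V} (hH : ∀ u, u ∈ I ∨ u ∈ S → ∀ w, H.Adj u w ↔ (supportGraph x).Adj u w)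
    {v : V} (hv : v ∈ I ∨ v ∈ S) :
    IsSmallStar k (H.connectedComponentMk v).toSimpleGraph ∨
      IsSpecialTree k (H.connectedComponentMk v).toSimpleGraph := by
  obtain ⟨s, hs, hsv⟩ : ∃ s ∈ S, v = s ∨ H.Adj s v := by
    rcases hv with hv | hv
    · obtain ⟨s, hs⟩ := h.exists_ne_zero hv
      exact ⟨s, (h.supp _ _ hs).2.1, Or.inr
        ((hH v (Or.inl hv) s).2 ((h.adj_left hv).2 hs)).symm⟩
    · exact ⟨v, hv, Or.inl rfl⟩
  have hcomp : H.connectedComponentMk v = H.connectedComponentMk s := by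
    rcases hsv with rfl | hsv
    · rfl
    · exact SimpleGraph.ConnectedComponent.sound hsv.symm.reachable
  rw [hcomp]
  have hcongr : ∀ {a j}, IsStarCenter j (supportGraph x) a → (a ∈ I ∨ a ∈ S) →
      IsStarCenter j H a := fun ha ha' =>
    ha.congr (T := {a | a ∈ I ∨ a ∈ S}) hH (fun u _ w hw => h.mem_union hw.symm) ha'
  -- If no unit at `s` comes from a split vertex, `s` is the centre of a star. Otherwise the common
  -- load of the two receivers decides between a `K_{1,2}` centred at the split vertex and a special
  -- tree.
  by_cases hx : ∀ u, x u s ≠ 1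
  · exact Or.inl ((hcongr (h.isStarCenter_right hs hx) (Or.inr hs)).isSmallStar (Or.inl rfl))
  · push Not at hx
    obtain ⟨u, hu⟩ := hx
    obtain ⟨t, hts, ht⟩ := h.exists_other hu
    have hu0 : x u s ≠ 0 := by omega
    have huI := (h.supp _ _ hu0).1
    rcases h.load_of_ne (by omega) hts.symm hu0 (by omega) with h1 | h1
    · have hc := hcongr (h.isStarCenter_left hts.symm hu0 (by omega) h1.1 h1.2) (Or.inl huI)
      refine Or.inl (IsStarCenter.isSmallStar ⟨hc.nonempty, hc.ncard_le.trans hk, hc.eq_of_adj⟩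
        (Or.inr ((hH u (Or.inl huI) s).2 ((h.adj_left huI).2 hu0))))
    · exact Or.inr (h.isSpecialTree (by omega) hH hs h1.1)

end IsMinAssignment

/-! ### From isolated vertices to the factor -/

section Main

variable {V : Type*} [Fintype V]

open Classical in
/-- The isolated vertices of `G - T`. -/
noncomputable def isolated (G : SimpleGraph V) (T : Finset V) : Finset V :=
  {v | v ∉ T ∧ ∀ w, G.Adj v w → w ∈ T}

theorem mem_isolated {G : SimpleGraph V} {T : Finset V} {v : V} :
    v ∈ isolated G T ↔ v ∉ T ∧ ∀ w, G.Adj v w → w ∈ T := by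
  simp [isolated]

/-- If deleting a set `T` never leaves more than `(k + 1 / 2) * #T` isolated vertices, then `G` has
a `{K_{1,1}, …, K_{1,k}, 𝒯(2k+1)}`-factor. -/
theorem hasStarTreeFactor_of_isolated {G : SimpleGraph V} {k : ℕ} (hk : 2 ≤ k)
    (hG : ∀ T, 2 * #(isolated G T) ≤ (2 * k + 1) * #T) : HasStarTreeFactor k G := by
  classical
  obtain ⟨S, hSmax⟩ : ∃ S, ∀ T, #(isolated G T) + #S ≤ #(isolated G S) + #T := by
    obtain ⟨S, -, hS⟩ := exists_max_image univ
      (fun T : Finset V => (#(isolated G T) : ℤ) - #T) univ_nonempty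
    exact ⟨S, fun T => by have := hS T (mem_univ T); omega⟩
  set I := isolated G S
  have hdisj : Disjoint I S := disjoint_left.2 fun v hv => (mem_isolated.1 hv).1
  have hIS : ∀ v ∈ I, ∀ w, G.Adj v w → w ∈ S := fun v hv => (mem_isolated.1 hv).2
  obtain ⟨x, hx⟩ : ∃ x, IsMinAssignment G.Adj I S (2 * k + 1) x := by
    refine exists_isMinAssignment hdisj (exists_isAssignment _ _ _ _ (by omega) ?_ ?_)
    · intro X hX
      refine le_trans (Nat.mul_le_mul_left _ (card_le_card fun v hv => ?_)) (hG _)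
      refine mem_isolated.2 ⟨fun h => ?_, fun w hw => ?_⟩
      · exact disjoint_left.1 hdisj (hX hv) (mem_filter.1 h).1
      · exact mem_filter.2 ⟨hIS v (hX hv) w hw, v, hv, hw⟩
    -- Removing `T` from `S` keeps isolated every vertex of `I` without neighbours in `T`, so
    -- maximality of `S` bounds `#T` by the number of neighbours of `T` in `I`.
    · intro T hT
      have h1 := hSmax (S \ T)
      have h2 : I \ {v ∈ I | ∃ s ∈ T, G.Adj v s} ⊆ isolated G (S \ T) := by
        intro v hv
        simp only [mem_sdiff, mem_filter, not_and, not_exists] at hv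
        refine mem_isolated.2 ⟨fun h => disjoint_left.1 hdisj hv.1 (mem_sdiff.1 h).1, ?_⟩
        exact fun w hw => mem_sdiff.2 ⟨hIS v hv.1 w hw, fun hwT => hv.2 hv.1 w hwT hw⟩
      have h3 := card_le_card h2
      rw [card_sdiff_of_subset (filter_subset _ _)] at h3
      rw [card_sdiff_of_subset hT] at h1
      have := card_le_card hT
      omega
  set U : Finset V := (I ∪ S)ᶜ
  have hU : ∀ v, v ∈ U ↔ ¬ (v ∈ I ∨ v ∈ S) := fun v => by simp [U]
  obtain ⟨f, hf, hfinj⟩ : ∃ f : V → V, (∀ u ∈ (U : Set V), f u ∈ (U : Set V) ∧ G.Adj u (f u)) ∧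
      Set.InjOn f U := by
    let t : U → Finset V := fun u => {w ∈ U | G.Adj u w}
    have hall : ∀ Y : Finset U, #Y ≤ #(Y.biUnion t) := by
      intro Y
      let X : Finset V := Y.map (Function.Embedding.subtype _)
      have hXU : ∀ v ∈ X, v ∈ U := by
        intro v hv
        obtain ⟨y, -, rfl⟩ := mem_map.1 hv
        exact y.2
      have hYt : ∀ w, w ∈ Y.biUnion t ↔ w ∈ U ∧ ∃ v ∈ X, G.Adj v w := by
        intro w
        simp only [mem_biUnion, t, mem_filter, X, mem_map]
        constructor
        · rintro ⟨y, hy, hw, ha⟩; exact ⟨hw, _, ⟨y, hy, rfl⟩, ha⟩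
        · rintro ⟨hw, _, ⟨y, hy, rfl⟩, ha⟩; exact ⟨y, hy, hw, ha⟩
      -- Vertices of `X` with a neighbour in `X` are themselves neighbours of `X`, so only the
      -- others, `X₀`, need new ones. Enlarging `S` by their neighbourhood `T` in `U` isolates `X₀`
      -- as well, so maximality gives `#X₀ ≤ #T`.
      let X₀ : Finset V := {v ∈ X | ∀ w ∈ X, ¬ G.Adj v w}
      let T : Finset V := {w ∈ U | ∃ v ∈ X₀, G.Adj v w}
      have hX₀ : #X₀ ≤ #T := by
        have h1 := hSmax (S ∪ T)
        have h2 : I ∪ X₀ ⊆ isolated G (S ∪ T) := by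
          intro v hv
          rcases mem_union.1 hv with hv | hv
          · refine mem_isolated.2 ⟨fun h => ?_, fun w hw => mem_union_left _ (hIS v hv w hw)⟩
            rcases mem_union.1 h with h | h
            · exact disjoint_left.1 hdisj hv h
            · exact (hU v).1 (mem_filter.1 h).1 (Or.inl hv)
          · have hvX := (mem_filter.1 hv).1
            have hvU := (hU v).1 (hXU v hvX)
            refine mem_isolated.2 ⟨fun h => ?_, fun w hw => ?_⟩
            · rcases mem_union.1 h with h | h
              · exact hvU (Or.inr h)
              · obtain ⟨-, z, hz, hzv⟩ := mem_filter.1 h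
                exact (mem_filter.1 hz).2 v hvX hzv
            · by_cases hwS : w ∈ S
              · exact mem_union_left _ hwS
              · refine mem_union_right _ (mem_filter.2 ⟨(hU w).2 ?_, v, hv, hw⟩)
                rintro (hwI | hwS')
                · exact hvU (Or.inr (hIS w hwI v hw.symm))
                · exact hwS hwS'
        have h3 := card_le_card h2
        rw [card_union_of_disjoint] at h3
        · have := card_union_le S T
          omega
        · refine disjoint_left.2 fun v hv hv' => ?_
          exact (hU v).1 (hXU v (mem_filter.1 hv').1) (Or.inl hv)
      have hsub : (X \ X₀) ∪ T ⊆ Y.biUnion t := by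
        intro w hw
        rw [hYt]
        rcases mem_union.1 hw with hw | hw
        · obtain ⟨hwX, hw0⟩ := mem_sdiff.1 hw
          refine ⟨hXU w hwX, ?_⟩
          by_contra! hcon
          exact hw0 (mem_filter.2 ⟨hwX, fun z hz h => hcon z hz h.symm⟩)
        · obtain ⟨hwU, v, hv, hvw⟩ := mem_filter.1 hw
          exact ⟨hwU, v, (mem_filter.1 hv).1, hvw⟩
      have h4 := card_le_card hsub
      have hX₀X : X₀ ⊆ X := filter_subset _ _
      rw [card_union_of_disjoint, card_sdiff_of_subset hX₀X] at h4
      · have h5 : #X = #Y := card_map _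
        have h6 := card_le_card hX₀X
        omega
      · refine disjoint_left.2 fun v hv hv' => ?_
        obtain ⟨-, z, hz, hzv⟩ := mem_filter.1 hv'
        exact (mem_filter.1 hz).2 v (mem_sdiff.1 hv).1 hzv
    obtain ⟨F, hF, hFt⟩ := (all_card_le_biUnion_card_iff_exists_injective t).1 hall
    refine ⟨fun v => if h : v ∈ U then F ⟨v, h⟩ else v, fun u hu => ?_, fun u hu w hw h => ?_⟩
    · have hu' : u ∈ U := hu
      simp only [dif_pos hu']
      exact mem_filter.1 (hFt ⟨u, hu'⟩)
    · have hu' : u ∈ U := hu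
      have hw' : w ∈ U := hw
      simp only [dif_pos hu', dif_pos hw'] at h
      exact congrArg Subtype.val (hF h)
  obtain ⟨P, hPG, hPU, hP⟩ := exists_star_cover hf hfinj
  have hH : ∀ u, u ∈ I ∨ u ∈ S → ∀ w, (supportGraph x ⊔ P).Adj u w ↔ (supportGraph x).Adj u w := by
    intro u hu w
    rw [SimpleGraph.sup_adj, or_iff_left]
    exact fun h => (hU u).1 (hPU u w h) hu
  refine ⟨supportGraph x ⊔ P, sup_le (fun u w huw => ?_) hPG, fun c => ?_⟩
  · rcases huw with ⟨-, h | h⟩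
    · exact (hx.supp _ _ h).2.2
    · exact (hx.supp _ _ h).2.2.symm
  · refine c.ind fun v => ?_
    by_cases hv : v ∈ I ∨ v ∈ S
    · exact hx.component hk hH hv
    · obtain ⟨a, ha, hav, hc⟩ := hP v ((hU v).2 hv)
      have hc' : IsStarCenter 2 (supportGraph x ⊔ P) a := by
        refine hc.congr (T := U) (fun u hu w => ?_) (fun u _ w hw => hPU _ _ hw.symm) ha
        rw [SimpleGraph.sup_adj, or_iff_right]
        exact fun h => (hU u).1 hu (hx.mem_union h)
      refine Or.inl (IsStarCenter.isSmallStar ⟨hc'.nonempty, hc'.ncard_le.trans hk, hc'.eq_of_adj⟩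
        (hav.imp_right fun h => Or.inr h))

end Main

end ComponentFactor

/-! ### The degree condition bounds isolated vertices -/

theorem theorem1p4 {V : Type*} [Fintype V] (G : SimpleGraph V) [DecidableRel G.Adj]
    (k : ℕ) (hk : 2 ≤ k) (hδ : 1 ≤ G.minDegree)
    (hdeg : ∀ s : Finset V, G.IsIndepSet (s : Set V) →
      s.card = ⌊((k : ℝ) + 1 / 2) * (G.minDegree : ℝ)⌋₊ + 1 →
      ∃ v ∈ s, 2 * (Fintype.card V : ℝ) / (2 * (k : ℝ) + 3) ≤ (G.degree v : ℝ)) :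
    ComponentFactor.HasStarTreeFactor k G := by
  classical
  refine ComponentFactor.hasStarTreeFactor_of_isolated hk fun T => ?_
  by_contra! hT
  set I := ComponentFactor.isolated G T
  have hdegT : ∀ v ∈ I, G.degree v ≤ T.card := by
    intro v hv
    refine Finset.card_le_card fun w hw => ?_
    exact (ComponentFactor.mem_isolated.1 hv).2 w (by simpa using hw)
  have hIT : T.card + I.card ≤ Fintype.card V := by
    rw [← Finset.card_union_of_disjoint]
    · exact Finset.card_le_univ _
    · exact Finset.disjoint_left.2 fun v hv hv' => (ComponentFactor.mem_isolated.1 hv').1 hv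
  obtain ⟨v₀, hv₀⟩ : I.Nonempty := Finset.card_pos.1 (by omega)
  have hδT : G.minDegree ≤ T.card := (G.minDegree_le_degree v₀).trans (hdegT v₀ hv₀)
  have hT' : (2 * (k : ℝ) + 1) * T.card < 2 * I.card := by exact_mod_cast hT
  have hδT' : (G.minDegree : ℝ) ≤ T.card := by exact_mod_cast hδT
  -- The strict bound `#I > (k + 1/2) * #T ≥ (k + 1/2) * δ` absorbs the `+ 1` after the floor.
  have hm : ⌊((k : ℝ) + 1 / 2) * (G.minDegree : ℝ)⌋₊ + 1 ≤ I.card := by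
    refine Nat.succ_le_of_lt ((Nat.floor_lt (by positivity)).2 ?_)
    have := mul_le_mul_of_nonneg_left hδT' (by positivity : (0 : ℝ) ≤ (k : ℝ) + 1 / 2)
    linarith
  obtain ⟨s, hsI, hs⟩ := Finset.exists_subset_card_eq hm
  obtain ⟨v, hv, hvd⟩ := hdeg s (fun a ha b hb _ hab =>
    (ComponentFactor.mem_isolated.1 (hsI hb)).1
      ((ComponentFactor.mem_isolated.1 (hsI ha)).2 b hab)) hs
  have hvT : (G.degree v : ℝ) ≤ T.card := by exact_mod_cast hdegT v (hsI hv)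
  have hIT' : (T.card : ℝ) + I.card ≤ Fintype.card V := by exact_mod_cast hIT
  rw [div_le_iff₀ (by positivity)] at hvd
  have := mul_le_mul_of_nonneg_right hvT (by positivity : (0 : ℝ) ≤ 2 * (k : ℝ) + 3)
  linarith
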